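/- Let $\Omega$ be a finite set. A generator on $\Omega$ is a real matrix $Q=(q(i,j))_{i,j\in\Omega}$ with $q(i,j)\ge 0$ for $i\ne j$ and all row sums equal to $0$; its departure rate at $i$ is $\sum_{j\ne i}q(i,j)$. For probability distributions $\mu,\nu$ on $\Omega$ let $\|\mu-\nu\|_{TV}=\frac12\sum_{x\in\Omega}|\mu(x)-\nu(x)|$. Let $Q_{initial}$ and $Q_{final}$ be generators on $\Omega$, and suppose that $\pi_f$ is the unique stationary distribution of $Q_{final}$, i.e. the unique probability distribution with $\pi_f Q_{final}=0$. For $\delta>0$ let $$t_{mix}(\delta)=\inf\{t\ge 0:\ \|\nu e^{tQ_{final}}-\pi_f\|_{TV}\le\delta\ \text{ for all probability distributions }\nu\text{ on }\Omega\}.$$ Let $Q[s]=(1-s)Q_{initial}+sQ_{final}$ for $0\le s\le 1$. For $T>0$ let $P_T(t_1,t_2)$, $0\le t_1\le t_2\le T$, be the transition matrices of the time-inhomogeneous Markov process generated by $Q[t/T]$, i.e. the solution of $P_T(t_1,t_1)=I$, $\frac{\partial}{\partial t_2}P_T(t_1,t_2)=P_T(t_1,t_2)\,Q[t_2/T]$.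 For $\epsilon>0$ let $$A_\epsilon=\{T>0:\ \|\nu P_T(0,T)-\pi_f\|_{TV}\le\epsilon\ \text{ for all probability distributions }\nu\text{ on }\Omega\},\qquad T_\epsilon=\inf A_\epsilon$$ ($T_\epsilon$ is called the adiabatic time). Theorem. Let $\epsilon>0$ and let $\lambda$ be a real number such that $$\lambda\ge\max_{i\in\Omega}\sum_{j\ne i}q_{initial}(i,j),\qquad \lambda\ge\max_{i\in\Omega}\sum_{j\ne i}q_{final}(i,j),\qquad \lambda\ge\frac{\epsilon}{2\,t_{mix}(\epsilon/2)}+1$$ (if $t_{mix}(\epsilon/2)=0$, the last condition is read as $\lambda\ge 1$). Then the infimum defining $t_{mix}(\epsilon/2)$ is over a non-empty set, $A_\epsilon$ is non-empty, $T_\epsilon$ is the least element of $A_\epsilon$ whenever $T_\epsilon>0$, and $$T_\epsilon\le\frac{\lambda\,t_{mix}(\epsilon/2)^2}{\epsilon}.$$ -/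

import Mathlib

/-! Finite-state continuous-time Markov processes: generators, mixing time, and the
time-inhomogeneous process driven by an interpolated generator. -/

section LinearODE

variable {𝔸 : Type*} [NormedRing 𝔸] [NormedAlgebra ℝ 𝔸]

/-- Iterated integrals `D₀ = 1`, `Dₙ₊₁(t) = ∫ₛᵗ Dₙ(u) G(u) du`; used only to show below that the
Kolmogorov forward equation can be solved. -/
noncomputable def dysonTerm (G : ℝ → 𝔸) (s : ℝ) : ℕ → ℝ → 𝔸
  | 0 => fun _ => 1
  | n + 1 => fun t => ∫ u in s..t, dysonTerm G s n u * G u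

theorem dysonTerm_continuous [CompleteSpace 𝔸] {G : ℝ → 𝔸} (hG : Continuous G) (s : ℝ) (n : ℕ) :
    Continuous (dysonTerm G s n) := by
  induction n with
  | zero => exact continuous_const
  | succ n ih =>
    exact intervalIntegral.continuous_primitive
      (fun a b => (ih.mul hG).intervalIntegrable a b) s

theorem dysonTerm_hasDerivAt [CompleteSpace 𝔸] {G : ℝ → 𝔸} (hG : Continuous G) (s : ℝ) (n : ℕ)
    (t : ℝ) : HasDerivAt (dysonTerm G s (n + 1)) (dysonTerm G s n t * G t) t := by
  have hc : Continuous fun u => dysonTerm G s n u * G u := (dysonTerm_continuous hG s n).mul hG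
  exact intervalIntegral.integral_hasDerivAt_right (hc.intervalIntegrable _ _)
    (hc.stronglyMeasurableAtFilter _ _) hc.continuousAt

theorem dysonTerm_norm_le [CompleteSpace 𝔸] {G : ℝ → 𝔸} {s R C : ℝ}
    (hG : Continuous G)
    (hC : ∀ t, |t - s| ≤ R → ‖G t‖ ≤ C) (n : ℕ) (t : ℝ) (ht : |t - s| ≤ R) :
    ‖dysonTerm G s n t‖ ≤ ‖(1 : 𝔸)‖ * ((C * |t - s|) ^ n / n.factorial) := by
  have hC0 : 0 ≤ C := (norm_nonneg _).trans (hC s (by simpa using (abs_nonneg _).trans ht))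
  induction n generalizing t with
  | zero => simp [dysonTerm]
  | succ n ih =>
    have hnn : 0 ≤ ‖(1 : 𝔸)‖ * (C ^ n / n.factorial) * C := by positivity
    have hle : ‖dysonTerm G s (n + 1) t‖ ≤
        ∫ u in Set.uIoc s t, ‖(1 : 𝔸)‖ * (C ^ n / n.factorial) * C * |u - s| ^ n := by
      refine intervalIntegral.norm_integral_le_integral_norm_uIoc.trans ?_
      have hc : Continuous fun u => dysonTerm G s n u * G u :=
        (dysonTerm_continuous hG s n).mul hG
      have hd : Continuous fun u : ℝ =>
          ‖(1 : 𝔸)‖ * (C ^ n / n.factorial) * C * |u - s| ^ n := by fun_prop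
      refine MeasureTheory.setIntegral_mono_on
        (intervalIntegrable_iff.mp (hc.norm.intervalIntegrable s t))
        (intervalIntegrable_iff.mp (hd.intervalIntegrable s t)) measurableSet_uIoc fun u hu => ?_
      have hu' : |u - s| ≤ R :=
        (Set.abs_sub_left_of_mem_uIcc (Set.uIoc_subset_uIcc hu)).trans ht
      calc ‖dysonTerm G s n u * G u‖ ≤ ‖dysonTerm G s n u‖ * ‖G u‖ := norm_mul_le _ _
        _ ≤ (‖(1 : 𝔸)‖ * ((C * |u - s|) ^ n / n.factorial)) * C := by
            gcongr
            · exact ih u hu'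
            · exact hC u hu'
        _ = _ := by rw [mul_pow]; ring
    refine hle.trans (le_of_eq ?_)
    rw [MeasureTheory.integral_const_mul, integral_pow_abs_sub_uIoc, Nat.factorial_succ, mul_pow]
    push_cast
    field_simp
    ring

/-- Linear equations `X' = X G` with continuous coefficient have a unique global solution. -/
theorem existsUnique_linear_ode [CompleteSpace 𝔸] {G : ℝ → 𝔸} (hG : Continuous G) (s : ℝ) :
    ∃! X : ℝ → 𝔸, X s = 1 ∧ ∀ t, HasDerivAt X (X t * G t) t := by
  have bound : ∀ R : ℝ, ∃ C : ℝ, ∀ t, |t - s| ≤ R → ‖G t‖ ≤ C := fun R => by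
    obtain ⟨C, hC⟩ := (isCompact_closedBall s R).exists_bound_of_continuousOn hG.continuousOn
    exact ⟨C, fun t ht => hC t (by simpa [Real.dist_eq] using ht)⟩
  have summ : ∀ t, Summable fun n => dysonTerm G s n t := fun t => by
    obtain ⟨C, hC⟩ := bound |t - s|
    exact Summable.of_norm_bounded
      ((Real.summable_pow_div_factorial (C * |t - s|)).mul_left ‖(1 : 𝔸)‖)
      fun n => dysonTerm_norm_le hG hC n t le_rfl
  have uniq : ∀ Y Z : ℝ → 𝔸, (Y s = 1 ∧ ∀ t, HasDerivAt Y (Y t * G t) t) →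
      (Z s = 1 ∧ ∀ t, HasDerivAt Z (Z t * G t) t) → Y = Z := by
    rintro Y Z ⟨hYs, hY⟩ ⟨hZs, hZ⟩
    funext t
    obtain ⟨C, hC⟩ := bound (|t - s| + 1)
    have ht : t ∈ Set.Ioo (s - (|t - s| + 1)) (s + (|t - s| + 1)) := by
      constructor <;> linarith [le_abs_self (t - s), neg_abs_le (t - s)]
    have hs : s ∈ Set.Ioo (s - (|t - s| + 1)) (s + (|t - s| + 1)) := by
      constructor <;> linarith [abs_nonneg (t - s)]
    refine ODE_solution_unique_of_mem_Ioo (v := fun u x => x * G u) (s := fun _ => Set.univ)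
      (K := C.toNNReal) (t₀ := s) (fun u hu => ?_) hs (fun u _ => ⟨hY u, trivial⟩)
      (fun u _ => ⟨hZ u, trivial⟩) (hYs.trans hZs.symm) ht
    refine LipschitzOnWith.of_dist_le_mul fun x _ y _ => ?_
    have hu' : ‖G u‖ ≤ C := hC u (abs_le.mpr ⟨by linarith [hu.1], by linarith [hu.2]⟩)
    rw [dist_eq_norm, dist_eq_norm, ← sub_mul, Real.coe_toNNReal _ ((norm_nonneg _).trans hu'),
      mul_comm]
    exact (norm_mul_le _ _).trans (mul_le_mul_of_nonneg_left hu' (norm_nonneg _))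
  refine existsUnique_of_exists_of_unique ⟨fun t => ∑' n, dysonTerm G s n t, ?_, fun t => ?_⟩ uniq
  · show ∑' n, dysonTerm G s n s = 1
    rw [tsum_eq_single 0]
    · rfl
    · intro n hn
      obtain ⟨m, rfl⟩ := Nat.exists_eq_succ_of_ne_zero hn
      simp [dysonTerm]
  · set R : ℝ := |t - s| + 1 with hR
    obtain ⟨C, hC⟩ := bound R
    have hRpos : 0 < R := by positivity
    have hC0 : 0 ≤ C := (norm_nonneg _).trans (hC s (by simpa using hRpos.le))
    have hmem : t ∈ Metric.ball s R := by simp [Real.dist_eq, hR]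
    have key := hasDerivAt_tsum_of_isPreconnected (𝕜 := ℝ)
      (u := fun n : ℕ => ‖(1 : 𝔸)‖ * ((C * R) ^ n / n.factorial) * C)
      (g := fun n => dysonTerm G s (n + 1)) (g' := fun n u => dysonTerm G s n u * G u)
      (t := Metric.ball s R) (y₀ := t) (y := t)
      (((Real.summable_pow_div_factorial (C * R)).mul_left _).mul_right _)
      Metric.isOpen_ball (convex_ball s R).isPreconnected
      (fun n u _ => dysonTerm_hasDerivAt hG s n u)
      (fun n u hu => by
        have hu' : |u - s| ≤ R := by
          have := Metric.mem_ball.mp hu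
          rw [Real.dist_eq] at this
          exact this.le
        refine (norm_mul_le _ _).trans ?_
        gcongr
        · refine (dysonTerm_norm_le hG hC n u hu').trans ?_
          gcongr
        · exact hC u hu')
      hmem ((summable_nat_add_iff 1).mpr (summ t)) hmem
    rw [(summ t).tsum_mul_right] at key
    have heq : (fun t => ∑' n, dysonTerm G s n t) =
        fun t => 1 + ∑' n, dysonTerm G s (n + 1) t := by
      funext u
      exact (summ u).tsum_eq_zero_add
    show HasDerivAt (fun t => ∑' n, dysonTerm G s n t) ((∑' n, dysonTerm G s n t) * G t) t
    rw [heq]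
    exact key.const_add 1

end LinearODE

section Markov

variable {Ω : Type*} [Fintype Ω] [DecidableEq Ω]

/-- Total variation distance between two distributions on a finite set. -/
noncomputable def tvDist (μ ν : Ω → ℝ) : ℝ := (1 / 2) * ∑ x, |μ x - ν x|

/-- Markov generators: nonnegative off-diagonal rates and zero row sums. -/
structure IsGenerator (Q : Matrix Ω Ω ℝ) : Prop where
  rate_nonneg : ∀ i j, i ≠ j → 0 ≤ Q i j
  row_sum : ∀ i, ∑ j, Q i j = 0

/-- The rate `∑_{j ≠ i} q(i,j)` at which the process leaves the state `i`. -/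
def departureRate (Q : Matrix Ω Ω ℝ) (i : Ω) : ℝ := ∑ j with j ≠ i, Q i j

/-- `μ` is a stationary probability distribution of the process generated by `Q`. -/
def IsStationaryDist (Q : Matrix Ω Ω ℝ) (μ : Ω → ℝ) : Prop :=
  μ ∈ stdSimplex ℝ Ω ∧ Matrix.vecMul μ Q = 0

/-- Transition matrix `P(t) = exp(tQ)` of the time-homogeneous process generated by `Q`. -/
noncomputable def homogeneousTransition (Q : Matrix Ω Ω ℝ) (t : ℝ) : Matrix Ω Ω ℝ :=
  NormedSpace.exp (t • Q)

/-- Times `t ≥ 0` at which the process generated by `Q` is `ε`-close to `π`, whatever its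
initial distribution. -/
def mixingTimes (Q : Matrix Ω Ω ℝ) (π : Ω → ℝ) (ε : ℝ) : Set ℝ :=
  {t | 0 ≤ t ∧ ∀ ν ∈ stdSimplex ℝ Ω,
    tvDist (Matrix.vecMul ν (homogeneousTransition Q t)) π ≤ ε}

/-- The mixing time `t_mix(ε)`. -/
noncomputable def mixingTime (Q : Matrix Ω Ω ℝ) (π : Ω → ℝ) (ε : ℝ) : ℝ :=
  sInf (mixingTimes Q π ε)

/-- `Q[s] = (1 - s) Q_initial + s Q_final`. -/
def interpolatedGenerator (Qi Qf : Matrix Ω Ω ℝ) (s : ℝ) : Matrix Ω Ω ℝ :=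
  (1 - s) • Qi + s • Qf

section

attribute [local instance] Matrix.linftyOpNormedRing Matrix.linftyOpNormedAlgebra

/-- The Kolmogorov forward equation `dP(s,t)/dt = P(s,t) G(t)`, `P(s,s) = 1`, has exactly one
solution, for every continuous family `G` of matrices. -/
theorem existsUnique_forward {G : ℝ → Matrix Ω Ω ℝ} (hG : Continuous G) (s : ℝ) :
    ∃! P : ℝ → Matrix Ω Ω ℝ,
      P s = 1 ∧ ∀ t i j, HasDerivAt (fun u => P u i j) ((P t * G t) i j) t := by
  have : CompleteSpace (Matrix Ω Ω ℝ) := FiniteDimensional.complete ℝ _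
  have h := existsUnique_linear_ode (𝔸 := Matrix Ω Ω ℝ) hG s
  have e : ∀ P : ℝ → Matrix Ω Ω ℝ,
      (P s = 1 ∧ ∀ t, HasDerivAt P (P t * G t) t) ↔
      (P s = 1 ∧ ∀ t i j, HasDerivAt (fun u => P u i j) ((P t * G t) i j) t) := by
    intro P
    refine and_congr_right fun _ => forall_congr' fun t => ?_
    rw [show HasDerivAt P (P t * G t) t ↔ _ from hasDerivAt_pi (E' := fun _ => Ω → ℝ)]
    exact forall_congr' fun i => hasDerivAt_pi
  exact (existsUnique_congr e).mp h

end

end Markov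

theorem continuous_interpolatedGenerator {Ω : Type*} (Qi Qf : Matrix Ω Ω ℝ) (T : ℝ) :
    Continuous fun t => interpolatedGenerator Qi Qf (t / T) := by
  unfold interpolatedGenerator
  fun_prop

section Adiabatic

variable {Ω : Type*} [Fintype Ω] [DecidableEq Ω]

/-- `adiabaticTransition Qi Qf T s t` is the transition matrix `P_T(s,t)` over the time interval
`[s,t]` of the time-inhomogeneous process generated by `Q[t/T]`: the solution of
`P_T(s,s) = 1`, `dP_T(s,t)/dt = P_T(s,t) Q[t/T]`. Only `0 ≤ s ≤ t ≤ T` is meaningful for the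
process, and the values there do not depend on how the equation is continued outside `[0,T]`. -/
noncomputable def adiabaticTransition (Qi Qf : Matrix Ω Ω ℝ) (T s : ℝ) : ℝ → Matrix Ω Ω ℝ :=
  (existsUnique_forward (continuous_interpolatedGenerator Qi Qf T) s).choose

theorem adiabaticTransition_self (Qi Qf : Matrix Ω Ω ℝ) (T s : ℝ) :
    adiabaticTransition Qi Qf T s s = 1 :=
  (existsUnique_forward (continuous_interpolatedGenerator Qi Qf T) s).choose_spec.1.1

theorem adiabaticTransition_hasDerivAt (Qi Qf : Matrix Ω Ω ℝ) (T s t : ℝ) (i j : Ω) :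
    HasDerivAt (fun u => adiabaticTransition Qi Qf T s u i j)
      ((adiabaticTransition Qi Qf T s t * interpolatedGenerator Qi Qf (t / T)) i j) t :=
  (existsUnique_forward (continuous_interpolatedGenerator Qi Qf T) s).choose_spec.1.2 t i j

/-- Durations `T > 0` for which the process generated by `Q[t/T]` is at time `T` `ε`-close to
`π`, whatever its initial distribution. -/
def adiabaticTimes (Qi Qf : Matrix Ω Ω ℝ) (π : Ω → ℝ) (ε : ℝ) : Set ℝ :=
  {T | 0 < T ∧ ∀ ν ∈ stdSimplex ℝ Ω,
    tvDist (Matrix.vecMul ν (adiabaticTransition Qi Qf T 0 T)) π ≤ ε}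

/-- The adiabatic time `T_ε`: the infimum of the durations that suffice. -/
noncomputable def adiabaticTime (Qi Qf : Matrix Ω Ω ℝ) (π : Ω → ℝ) (ε : ℝ) : ℝ :=
  sInf (adiabaticTimes Qi Qf π ε)

end Adiabatic

/-! The `ℓ^∞` operator norm on matrices, the largest `ℓ¹` norm of a row, turns the statement into one
about a Banach algebra. The worst total variation distance from `π` over all initial
distributions is half the norm of the difference to the matrix `constRows π`
(`forall_tvDist_le_iff`), and a generator `Q` with departure rates at most `l` satisfies
`‖Q + l‖ ≤ l`, so that the equation `X' = X Q` does not increase norms (`norm_le_of_dissipative`).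

Put `τ = t_mix(ε/2)` and `T = l τ² / ε`. If `τ ≤ T`, the driven process on `[T - τ, T]` is compared
with the one generated by `Q_final`. At time `t` the generators differ by
`(1 - t/T) (Q_initial - Q_final)`, of norm at most `2 l (1 - t/T)`, which integrates to
`l τ² / T = ε`; mixing from the distribution at time `T - τ` contributes another `ε`, and the
sum `2 ε` is a total variation distance of `ε`. If `T < τ`, the comparison is with
`e^{(τ - T) Q_final} e^{t Q_final}` on the whole of `[0, T]`; the error `2 l (τ - T) + l T` is again
at most `ε` because `(l τ - ε)² ≥ 0`. Both cases are in
`norm_interpolated_sub_le_of_norm_exp_sub_le`.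

That mixing times exist is the convergence theorem `exists_norm_exp_sub_constRows_le`. Writing
`Q = l (S - 1)` with `‖S‖ ≤ 1`, the semigroup is a Poisson average of the powers of `S`, and the
variance of the Poisson distribution gives `‖Q e^{tQ}‖ ≤ l / √(l t)`
(`norm_mul_exp_le_of_dissipative`). A limit point of `e^{tQ}` thus has stationary distributions as
its rows, and can only be `constRows π`.

The mixing time, and the adiabatic time when it is positive, are attained because the transition
matrices depend continuously on `t` and on the time scale `T` (`mixingTime_mem_mixingTimes`,
`isLeast_adiabaticTime`). If `τ = 0`, every `T > 0` is an adiabatic time. -/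

/-! ### Dissipative linear equations in a Banach algebra -/

section Dissipative

variable {𝔸 : Type*} [NormedRing 𝔸] [NormedAlgebra ℝ 𝔸]

/-- Variation of constants as an inequality: if `‖G + l‖ ≤ l`, the homogeneous equation `X' = X G`
does not increase norms, so the norm of a solution of `X' = X G + H` grows at most at the
rate `‖H‖`. -/
theorem norm_le_of_dissipative {X G H : ℝ → 𝔸} {N N' : ℝ → ℝ} {l a b : ℝ}
    (hX : ∀ t, HasDerivAt X (X t * G t + H t) t)
    (hG : ∀ t ∈ Set.Icc a b, ‖G t + l • (1 : 𝔸)‖ ≤ l)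
    (hN : ∀ t, HasDerivAt N (N' t) t)
    (hH : ∀ t ∈ Set.Icc a b, ‖H t‖ ≤ N' t) (ha : ‖X a‖ ≤ N a) {t : ℝ} (ht : t ∈ Set.Icc a b) :
    ‖X t‖ ≤ N t := by
  -- The factor `e^{l t}` turns `G` into `G + l`, at the price of an exponential bound; the slack
  -- `η` makes the comparison of derivatives strict.
  have key : ∀ η : ℝ, 0 < η → ‖X t‖ ≤ N t + η * (t - a) := by
    intro η hη
    have he : ∀ u, HasDerivAt (fun u => Real.exp (l * u)) (Real.exp (l * u) * l) u := fun u => by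
      simpa using ((hasDerivAt_id u).const_mul l).exp
    have hf : ∀ u, HasDerivAt (fun u => Real.exp (l * u) • X u)
        (Real.exp (l * u) • (X u * G u + H u) + (Real.exp (l * u) * l) • X u) u :=
      fun u => (he u).smul (hX u)
    have hB : ∀ u, HasDerivAt (fun u => Real.exp (l * u) * (N u + η * (u - a)))
        (Real.exp (l * u) * l * (N u + η * (u - a)) + Real.exp (l * u) * (N' u + η)) u :=
      fun u => (he u).mul ((hN u).add (by simpa using ((hasDerivAt_id u).sub_const a).const_mul η))
    have h := image_norm_le_of_norm_deriv_right_lt_deriv_boundary (a := a) (b := b)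
      (fun u _ => (hf u).continuousAt.continuousWithinAt)
      (fun u _ => (hf u).hasDerivWithinAt) (B := fun u => Real.exp (l * u) * (N u + η * (u - a)))
      (by simpa [norm_smul] using mul_le_mul_of_nonneg_left ha (Real.exp_pos (l * a)).le) hB
      (fun u hu heq => ?_) ht
    · rw [norm_smul, Real.norm_of_nonneg (Real.exp_pos _).le] at h
      exact le_of_mul_le_mul_left h (Real.exp_pos _)
    · rw [norm_smul, Real.norm_of_nonneg (Real.exp_pos _).le] at heq
      have heq' := mul_left_cancel₀ (Real.exp_pos _).ne' heq
      have hu' := Set.Ico_subset_Icc_self hu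
      have hrw : Real.exp (l * u) • (X u * G u + H u) + (Real.exp (l * u) * l) • X u =
          Real.exp (l * u) • (X u * (G u + l • (1 : 𝔸)) + H u) := by
        rw [mul_add, mul_smul_comm, mul_one, mul_smul, ← smul_add]
        congr 1
        abel
      rw [hrw, norm_smul, Real.norm_of_nonneg (Real.exp_pos _).le, mul_assoc, ← mul_add]
      refine mul_lt_mul_of_pos_left ?_ (Real.exp_pos _)
      have h1 : ‖X u * (G u + l • (1 : 𝔸))‖ ≤ ‖X u‖ * l :=
        (norm_mul_le _ _).trans (mul_le_mul_of_nonneg_left (hG u hu') (norm_nonneg _))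
      have h2 := norm_add_le (X u * (G u + l • (1 : 𝔸))) (H u)
      have h3 := hH u hu'
      rw [heq'] at h1
      linarith
  have hlim : Filter.Tendsto (fun η : ℝ => N t + η * (t - a)) (nhdsWithin 0 (Set.Ioi 0))
      (nhds (N t)) := by
    have : Continuous fun η : ℝ => N t + η * (t - a) := by fun_prop
    simpa using (this.tendsto 0).mono_left nhdsWithin_le_nhds
  exact ge_of_tendsto hlim (Filter.eventually_of_mem self_mem_nhdsWithin key)

theorem norm_interpolation_add_le {A B : 𝔸} {l s : ℝ} (hA : ‖A + l • (1 : 𝔸)‖ ≤ l)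
    (hB : ‖B + l • (1 : 𝔸)‖ ≤ l) (hs : s ∈ Set.Icc (0 : ℝ) 1) :
    ‖(1 - s) • A + s • B + l • (1 : 𝔸)‖ ≤ l := by
  have h : (1 - s) • A + s • B + l • (1 : 𝔸) =
      (1 - s) • (A + l • (1 : 𝔸)) + s • (B + l • (1 : 𝔸)) := by module
  rw [h]
  refine (norm_add_le _ _).trans ?_
  rw [norm_smul, norm_smul, Real.norm_of_nonneg hs.1,
    Real.norm_of_nonneg (sub_nonneg.2 hs.2)]
  nlinarith [hs.1, hs.2]

theorem norm_sub_le_of_dissipative {A B : 𝔸} {l : ℝ} (hA : ‖A + l • (1 : 𝔸)‖ ≤ l)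
    (hB : ‖B + l • (1 : 𝔸)‖ ≤ l) : ‖A - B‖ ≤ 2 * l := by
  have h : A - B = (A + l • (1 : 𝔸)) - (B + l • (1 : 𝔸)) := by abel
  rw [h]
  linarith [norm_sub_le (A + l • (1 : 𝔸)) (B + l • (1 : 𝔸))]

theorem norm_le_of_dissipative_generator {A : 𝔸} {l : ℝ} (hA : ‖A + l • (1 : 𝔸)‖ ≤ l)
    (h1 : ‖(1 : 𝔸)‖ ≤ 1) : ‖A‖ ≤ 2 * l := by
  have hl : 0 ≤ l := (norm_nonneg _).trans hA
  have h0 : ‖(0 : 𝔸) + l • (1 : 𝔸)‖ ≤ l := by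
    rw [zero_add, norm_smul, Real.norm_of_nonneg hl]
    nlinarith
  simpa using norm_sub_le_of_dissipative hA h0

/-- The solution of the interpolated equation on the time scale `T` has norm at most one. -/
theorem norm_interpolated_le_one {A B : 𝔸} {l T : ℝ} (hA : ‖A + l • (1 : 𝔸)‖ ≤ l)
    (hB : ‖B + l • (1 : 𝔸)‖ ≤ l) (h1 : ‖(1 : 𝔸)‖ ≤ 1) (hT : 0 < T) {X : ℝ → 𝔸} (hX0 : X 0 = 1)
    (hX : ∀ t, HasDerivAt X (X t * ((1 - t / T) • A + (t / T) • B)) t) {t : ℝ}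
    (ht : t ∈ Set.Icc 0 T) : ‖X t‖ ≤ 1 :=
  norm_le_of_dissipative (H := fun _ => 0) (N := fun _ => 1) (N' := fun _ => 0)
    (fun u => by simpa using hX u)
    (fun u hu => norm_interpolation_add_le hA hB
      ⟨div_nonneg hu.1 hT.le, (div_le_one hT).2 hu.2⟩)
    (fun u => hasDerivAt_const _ _) (fun u _ => by simp) (by simpa [hX0] using h1) ht

/-- The final value of the interpolated solution is a Lipschitz function of the time scale. Both
solutions are brought to the interval `[0, 1]`, where they satisfy `Y' = T Y Q[s]`. -/
theorem norm_interpolated_sub_le {A B : 𝔸} {l T T' : ℝ} (hA : ‖A + l • (1 : 𝔸)‖ ≤ l)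
    (hB : ‖B + l • (1 : 𝔸)‖ ≤ l) (h1 : ‖(1 : 𝔸)‖ ≤ 1) (hT : 0 < T) (hT' : 0 < T')
    {X X' : ℝ → 𝔸} (hX0 : X 0 = 1)
    (hX : ∀ t, HasDerivAt X (X t * ((1 - t / T) • A + (t / T) • B)) t) (hX0' : X' 0 = 1)
    (hX' : ∀ t, HasDerivAt X' (X' t * ((1 - t / T') • A + (t / T') • B)) t) :
    ‖X T - X' T'‖ ≤ 2 * l * |T - T'| := by
  have hl : 0 ≤ l := (norm_nonneg _).trans hA
  have scaled : ∀ {S : ℝ} {Y : ℝ → 𝔸}, 0 < S →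
      (∀ t, HasDerivAt Y (Y t * ((1 - t / S) • A + (t / S) • B)) t) → ∀ s,
      HasDerivAt (fun s => Y (S * s)) (S • (Y (S * s) * ((1 - s) • A + s • B))) s := by
    intro S Y hS hY s
    have := (hY (S * s)).scomp s (by simpa using (hasDerivAt_id s).const_mul S)
    rwa [mul_div_cancel_left₀ _ hS.ne'] at this
  have h := norm_le_of_dissipative (X := fun s => X (T * s) - X' (T' * s))
    (G := fun s => T • ((1 - s) • A + s • B))
    (H := fun s => (T - T') • (X' (T' * s) * ((1 - s) • A + s • B)))
    (N := fun s => 2 * l * |T - T'| * s) (N' := fun _ => 2 * l * |T - T'|) (l := T * l)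
    (a := 0) (b := 1) (t := 1) (fun s => ?_) (fun s hs => ?_)
    (fun s => by simpa using (hasDerivAt_id s).const_mul (2 * l * |T - T'|)) (fun s hs => ?_)
    (by simp [hX0, hX0']) (by simp)
  · simpa using h
  · refine ((scaled hT hX s).sub (scaled hT' hX' s)).congr_deriv ?_
    rw [sub_mul, mul_smul_comm, mul_smul_comm]
    module
  · rw [mul_smul, ← smul_add, norm_smul, Real.norm_of_nonneg hT.le]
    exact mul_le_mul_of_nonneg_left (norm_interpolation_add_le hA hB hs) hT.le
  · have h2 : ‖X' (T' * s)‖ ≤ 1 := norm_interpolated_le_one hA hB h1 hT' hX0' hX'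
      ⟨mul_nonneg hT'.le hs.1, mul_le_of_le_one_right hT'.le hs.2⟩
    have h3 : ‖(1 - s) • A + s • B‖ ≤ 2 * l :=
      norm_le_of_dissipative_generator (norm_interpolation_add_le hA hB hs) h1
    rw [norm_smul, Real.norm_eq_abs, mul_comm]
    refine mul_le_mul_of_nonneg_right ?_ (abs_nonneg _)
    calc _ ≤ ‖X' (T' * s)‖ * ‖(1 - s) • A + s • B‖ := norm_mul_le _ _
      _ ≤ 1 * (2 * l) := by gcongr
      _ = 2 * l := one_mul _

/-- An element annihilated by both generators is fixed by the interpolated solution. For matrices this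
expresses that the rows of the transition matrices sum to one. -/
theorem interpolated_mul_eq {A B R : 𝔸} {T : ℝ} {X : ℝ → 𝔸} (hX0 : X 0 = 1)
    (hX : ∀ t, HasDerivAt X (X t * ((1 - t / T) • A + (t / T) • B)) t)
    (hAR : A * R = 0) (hBR : B * R = 0) (t : ℝ) : X t * R = R := by
  have hd : ∀ u, HasDerivAt (fun u => X u * R) 0 u := fun u => by
    simpa [mul_assoc, add_mul, hAR, hBR] using (hX u).mul_const R
  have := is_const_of_deriv_eq_zero (fun u => (hd u).differentiableAt) (fun u => (hd u).deriv) t 0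
  simpa [hX0] using this

variable [CompleteSpace 𝔸]

theorem norm_exp_le_one_of_dissipative {B : 𝔸} {l : ℝ} (hB : ‖B + l • (1 : 𝔸)‖ ≤ l)
    (h1 : ‖(1 : 𝔸)‖ ≤ 1) {t : ℝ} (ht : 0 ≤ t) : ‖NormedSpace.exp (t • B)‖ ≤ 1 :=
  norm_le_of_dissipative (X := fun t : ℝ => NormedSpace.exp (t • B)) (G := fun _ => B)
    (H := fun _ => 0) (N := fun _ => 1) (N' := fun _ => 0) (a := 0) (b := t)
    (fun u => by simpa using hasDerivAt_exp_smul_const B u) (fun _ _ => hB)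
    (fun u => hasDerivAt_const _ _) (fun u _ => by simp)
    (by simpa using h1) ⟨ht, le_rfl⟩

theorem norm_exp_sub_one_le {B : 𝔸} {l : ℝ} (hB : ‖B + l • (1 : 𝔸)‖ ≤ l)
    (h1 : ‖(1 : 𝔸)‖ ≤ 1) {t : ℝ} (ht : 0 ≤ t) : ‖NormedSpace.exp (t • B) - 1‖ ≤ 2 * l * t :=
  norm_le_of_dissipative (X := fun t : ℝ => NormedSpace.exp (t • B) - 1) (G := fun _ => B)
    (H := fun _ => B) (N := fun t => 2 * l * t) (N' := fun _ => 2 * l) (a := 0) (b := t)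
    (fun u => by simpa [sub_mul] using (hasDerivAt_exp_smul_const B u).sub_const 1)
    (fun _ _ => hB)
    (fun u => by simpa using (hasDerivAt_id u).const_mul (2 * l))
    (fun u _ => norm_le_of_dissipative_generator hB h1)
    (by simp) ⟨ht, le_rfl⟩

/-- Duhamel comparison of the interpolated solution on `[a, T]` with the semigroup generated by the
final generator `B`, started from an arbitrary `E`. The generators differ by `(1 - t/T) (A - B)`,
whose norm integrates to at most `l (T - a)² / T`. -/
theorem norm_interpolated_sub_semigroup_le {A B : 𝔸} {l T a : ℝ} (hA : ‖A + l • (1 : 𝔸)‖ ≤ l)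
    (hB : ‖B + l • (1 : 𝔸)‖ ≤ l) (h1 : ‖(1 : 𝔸)‖ ≤ 1) (hT : 0 < T) {X : ℝ → 𝔸} (hX0 : X 0 = 1)
    (hX : ∀ t, HasDerivAt X (X t * ((1 - t / T) • A + (t / T) • B)) t) (ha : 0 ≤ a) (haT : a ≤ T)
    (E : 𝔸) :
    ‖X T - E * NormedSpace.exp ((T - a) • B)‖ ≤ ‖X a - E‖ + l * (T - a) ^ 2 / T := by
  have hl : 0 ≤ l := (norm_nonneg _).trans hA
  have hN : ∀ t, HasDerivAt
      (fun t => ‖X a - E‖ + (l * (T - a) ^ 2 / T - l * (T - t) ^ 2 / T))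
      (2 * l * (1 - t / T)) t := by
    intro t
    have h := ((((((hasDerivAt_id t).const_sub T).pow 2).const_mul l).div_const T).const_sub
      (l * (T - a) ^ 2 / T)).const_add ‖X a - E‖
    refine h.congr_deriv ?_
    simp only [id, Nat.cast_ofNat]
    field_simp
    ring
  have h := norm_le_of_dissipative
    (X := fun t => X t - E * NormedSpace.exp ((t - a) • B)) (G := fun _ => B)
    (H := fun t => (1 - t / T) • (X t * (A - B))) (l := l) (a := a) (b := T) (t := T)
    (fun t => ?_) (fun _ _ => hB) hN (fun t ht => ?_) (by simp) ⟨haT, le_rfl⟩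
  · simpa using h
  · have h2 : HasDerivAt (fun t => NormedSpace.exp ((t - a) • B))
        (NormedSpace.exp ((t - a) • B) * B) t := by
      exact ((hasDerivAt_exp_smul_const B (t - a)).scomp t
        ((hasDerivAt_id t).sub_const a)).congr_deriv (one_smul _ _)
    refine ((hX t).sub (h2.const_mul E)).congr_deriv ?_
    simp only [mul_add, mul_sub, sub_mul, mul_smul_comm, mul_assoc]
    module
  · have ht0 : 0 ≤ t := ha.trans ht.1
    have h2 : 0 ≤ 1 - t / T := sub_nonneg.2 ((div_le_one hT).2 ht.2)
    rw [norm_smul, Real.norm_of_nonneg h2, mul_comm]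
    refine mul_le_mul_of_nonneg_right ?_ h2
    calc _ ≤ ‖X t‖ * ‖A - B‖ := norm_mul_le _ _
      _ ≤ 1 * (2 * l) := by
        gcongr
        · exact norm_interpolated_le_one hA hB h1 hT hX0 hX ⟨ht0, ht.2⟩
        · exact norm_sub_le_of_dissipative hA hB
      _ = 2 * l := one_mul _

/-- The adiabatic estimate. If `e^{τB}` is `ε`-close to `R`, then the interpolated solution on the
time scale `T` is `2ε`-close to `R`, both for `T ≥ τ` with `l τ² ≤ ε T` and for `T = l τ² / ε`
without any restriction. -/
theorem norm_interpolated_sub_le_of_norm_exp_sub_le {A B R : 𝔸} {l T τ ε : ℝ}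
    (hA : ‖A + l • (1 : 𝔸)‖ ≤ l) (hB : ‖B + l • (1 : 𝔸)‖ ≤ l) (h1 : ‖(1 : 𝔸)‖ ≤ 1) (hT : 0 < T)
    {X : ℝ → 𝔸} (hX0 : X 0 = 1)
    (hX : ∀ t, HasDerivAt X (X t * ((1 - t / T) • A + (t / T) • B)) t)
    (hAR : A * R = 0) (hBR : B * R = 0) (hτ : 0 ≤ τ) (hε : 0 < ε)
    (hmix : ‖NormedSpace.exp (τ • B) - R‖ ≤ ε)
    (hlT : (τ ≤ T ∧ l * τ ^ 2 ≤ ε * T) ∨ l * τ ^ 2 = ε * T) :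
    ‖X T - R‖ ≤ 2 * ε := by
  have hl : 0 ≤ l := (norm_nonneg _).trans hA
  rcases le_or_gt τ T with hτT | hτT
  -- The comparison is made on the last stretch `[T - τ, T]` only.
  · have hlT' : l * τ ^ 2 / T ≤ ε := by
      rw [div_le_iff₀ hT]
      rcases hlT with h | h
      exacts [h.2, h.le]
    have h2 := norm_interpolated_sub_semigroup_le hA hB h1 hT hX0 hX (sub_nonneg.2 hτT)
      (sub_le_self T hτ) (X (T - τ))
    rw [sub_sub_cancel, sub_self, norm_zero, zero_add] at h2
    have h3 : ‖X (T - τ) * NormedSpace.exp (τ • B) - R‖ ≤ ε := by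
      have h4 : X (T - τ) * NormedSpace.exp (τ • B) - R =
          X (T - τ) * (NormedSpace.exp (τ • B) - R) := by
        rw [mul_sub, interpolated_mul_eq hX0 hX hAR hBR]
      rw [h4]
      calc _ ≤ ‖X (T - τ)‖ * ‖NormedSpace.exp (τ • B) - R‖ := norm_mul_le _ _
        _ ≤ 1 * ε := by
          gcongr
          exact norm_interpolated_le_one hA hB h1 hT hX0 hX
            ⟨sub_nonneg.2 hτT, sub_le_self T hτ⟩
        _ = ε := one_mul _
    have h5 := norm_sub_le_norm_sub_add_norm_sub (X T)
      (X (T - τ) * NormedSpace.exp (τ • B)) R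
    linarith
  -- The time `T` is too short for `τ`; the comparison is with `e^{(τ - T)B} e^{tB}` on `[0, T]`,
  -- and the bound `2 l (τ - T) + l T ≤ ε` is `(l τ - ε)² ≥ 0`.
  · have hlT' : l * τ ^ 2 = ε * T := hlT.resolve_left fun h => absurd h.1 (not_le.2 hτT)
    have hsplit : NormedSpace.exp (τ • B) =
        NormedSpace.exp ((τ - T) • B) * NormedSpace.exp ((T - 0) • B) := by
      let _ : NormedAlgebra ℚ 𝔸 := NormedAlgebra.restrictScalars ℚ ℝ 𝔸
      rw [← NormedSpace.exp_add_of_commute, ← add_smul]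
      · congr 2; ring
      · exact ((Commute.refl B).smul_left _).smul_right _
    have h2 := norm_interpolated_sub_semigroup_le hA hB h1 hT hX0 hX le_rfl hT.le
      (NormedSpace.exp ((τ - T) • B))
    have h3 := norm_exp_sub_one_le hB h1 (sub_nonneg.2 hτT.le)
    have h4 : l * (T - 0) ^ 2 / T = l * T := by field_simp; ring
    rw [hX0, ← hsplit, h4, norm_sub_rev 1] at h2
    have h5 := norm_sub_le_norm_sub_add_norm_sub (X T) (NormedSpace.exp (τ • B)) R
    have h6 : 2 * l * (τ - T) + l * T ≤ ε := by
      refine le_of_mul_le_mul_left ?_ hε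
      nlinarith [sq_nonneg (l * τ - ε)]
    linarith

end Dissipative

/-! ### Decay of the derivative of a dissipative semigroup -/

section Decay

open scoped Nat

/-- The variance of the Poisson distribution with mean `m`, without the normalizing `e^{-m}`. -/
theorem hasSum_poisson_variance {m : ℝ} (hm : 0 < m) :
    HasSum (fun n : ℕ => m ^ n / n ! * (n / m - 1) ^ 2) (Real.exp m / m) := by
  have h0 : HasSum (fun n : ℕ => m ^ n / n !) (Real.exp m) := by
    rw [Real.exp_eq_exp_ℝ]
    exact NormedSpace.expSeries_div_hasSum_exp m
  have shift : ∀ {f : ℕ → ℝ} {s : ℝ}, HasSum (fun n : ℕ => m ^ n / n ! * f n) s →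
      HasSum (fun n : ℕ => m ^ n / n ! * (n * f (n - 1))) (m * s) := by
    intro f s hf
    refine (hasSum_nat_add_iff' 1).1 ?_
    rw [Finset.sum_range_one, Nat.cast_zero, zero_mul, mul_zero, sub_zero]
    refine HasSum.congr_fun (hf.mul_left m) fun n => ?_
    rw [Nat.factorial_succ, Nat.add_sub_cancel]
    push_cast
    field_simp
    ring
  have h1 := shift (f := fun _ => 1) (by simpa using h0)
  have h2 := shift (f := fun n => n) (by simpa using h1)
  have h3 := ((h2.add h1).mul_left (m ^ 2)⁻¹).sub ((h1.mul_left (2 / m)).sub h0)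
  have hval : (m ^ 2)⁻¹ * (m * (m * Real.exp m) + m * Real.exp m) -
      (2 / m * (m * Real.exp m) - Real.exp m) = Real.exp m / m := by
    field_simp
    ring
  rw [hval] at h3
  refine HasSum.congr_fun h3 fun n => ?_
  rcases n with _ | n
  · simp
  · rw [Nat.add_sub_cancel]
    push_cast
    field_simp
    ring

variable {𝔸 : Type*} [NormedRing 𝔸] [NormedAlgebra ℝ 𝔸] [CompleteSpace 𝔸]

/-- Summation by parts writes `(S - 1) e^{mS}` as `∑ (n / m - 1) mⁿ Sⁿ / n!`, and the coefficients
are controlled by the variance of the Poisson distribution. -/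
theorem norm_sub_one_mul_exp_le {S : 𝔸} (hS : ‖S‖ ≤ 1) (h1 : ‖(1 : 𝔸)‖ ≤ 1) {m : ℝ} (hm : 0 < m) :
    ‖(S - 1) * NormedSpace.exp (m • S)‖ ≤ Real.exp m / √m := by
  have h0 : HasSum (fun n : ℕ => m ^ n / n !) (Real.exp m) := by
    rw [Real.exp_eq_exp_ℝ]
    exact NormedSpace.expSeries_div_hasSum_exp m
  have hexp : HasSum (fun n : ℕ => (m ^ n / n !) • S ^ n) (NormedSpace.exp (m • S)) := by
    convert NormedSpace.exp_series_hasSum_exp' (𝕂 := ℝ) (m • S) using 2 with n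
    rw [smul_pow, smul_smul, div_eq_inv_mul]
  have hmul : HasSum (fun n : ℕ => (m ^ n / n ! * (n / m)) • S ^ n)
      (S * NormedSpace.exp (m • S)) := by
    refine (hasSum_nat_add_iff' 1).1 ?_
    rw [Finset.sum_range_one, Nat.cast_zero, zero_div, mul_zero, zero_smul, sub_zero]
    refine HasSum.congr_fun (hexp.mul_left S) fun n => ?_
    rw [mul_smul_comm, ← pow_succ', Nat.factorial_succ]
    congr 1
    push_cast
    field_simp
    ring
  have hdiff : HasSum (fun n : ℕ => (m ^ n / n ! * (n / m - 1)) • S ^ n)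
      ((S - 1) * NormedSpace.exp (m • S)) := by
    rw [sub_mul, one_mul]
    refine HasSum.congr_fun (hmul.sub hexp) fun n => ?_
    rw [← sub_smul, mul_sub, mul_one]
  have hbd := ((h0.mul_right (1 / √m)).add ((hasSum_poisson_variance hm).mul_right (√m))).mul_right
    (1 / 2 : ℝ)
  have hpos : 0 < √m := Real.sqrt_pos.2 hm
  have hval : (Real.exp m * (1 / √m) + Real.exp m / m * √m) * (1 / 2) = Real.exp m / √m := by
    field_simp
    rw [Real.sq_sqrt hm.le]
    ring
  rw [hval] at hbd
  refine hdiff.norm_le_of_bounded hbd fun n => ?_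
  have hpow : ‖S ^ n‖ ≤ 1 := by
    induction n with
    | zero => simpa using h1
    | succ n ih =>
      rw [pow_succ]
      exact (norm_mul_le _ _).trans (mul_le_one₀ ih (norm_nonneg _) hS)
  have hc : 0 ≤ m ^ n / n ! := by positivity
  -- Young's inequality `2 |x| ≤ 1 / √m + √m x²`.
  have hx : |(n / m - 1 : ℝ)| ≤ (1 / √m + (n / m - 1) ^ 2 * √m) * (1 / 2) := by
    have h2 : 0 ≤ √m * (|(n / m - 1 : ℝ)| - 1 / √m) ^ 2 := by positivity
    have h3 : √m * (|(n / m - 1 : ℝ)| - 1 / √m) ^ 2 =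
        √m * |(n / m - 1 : ℝ)| ^ 2 - 2 * |(n / m - 1 : ℝ)| + 1 / √m := by
      field_simp
      ring
    rw [h3, sq_abs] at h2
    linarith
  calc ‖(m ^ n / n ! * (n / m - 1)) • S ^ n‖
      = m ^ n / n ! * |(n / m - 1 : ℝ)| * ‖S ^ n‖ := by
        rw [norm_smul, norm_mul, Real.norm_of_nonneg hc, Real.norm_eq_abs]
    _ ≤ m ^ n / n ! * |(n / m - 1 : ℝ)| * 1 := by gcongr
    _ ≤ m ^ n / n ! * ((1 / √m + (n / m - 1) ^ 2 * √m) * (1 / 2)) := by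
        rw [mul_one]; gcongr
    _ = _ := by ring

theorem norm_mul_exp_le_of_dissipative {B : 𝔸} {l : ℝ} (hl : 0 < l)
    (hB : ‖B + l • (1 : 𝔸)‖ ≤ l) (h1 : ‖(1 : 𝔸)‖ ≤ 1) {t : ℝ} (ht : 0 < t) :
    ‖B * NormedSpace.exp (t • B)‖ ≤ l / √(l * t) := by
  set S : 𝔸 := l⁻¹ • (B + l • (1 : 𝔸)) with hS
  have hS1 : ‖S‖ ≤ 1 := by
    rw [hS, norm_smul, Real.norm_of_nonneg (inv_pos.2 hl).le]
    calc l⁻¹ * ‖B + l • (1 : 𝔸)‖ ≤ l⁻¹ * l := by gcongr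
      _ = 1 := inv_mul_cancel₀ hl.ne'
  have hBS : B = l • (S - 1) := by
    rw [hS, smul_sub, smul_smul, mul_inv_cancel₀ hl.ne', one_smul, add_sub_cancel_right]
  have hexp : NormedSpace.exp (t • B) =
      Real.exp (-(l * t)) • NormedSpace.exp ((l * t) • S) := by
    have h2 : t • B = (l * t) • S + algebraMap ℝ 𝔸 (-(l * t)) := by
      rw [hBS, Algebra.algebraMap_eq_smul_one]
      module
    let _ : NormedAlgebra ℚ 𝔸 := NormedAlgebra.restrictScalars ℚ ℝ 𝔸
    rw [h2, NormedSpace.exp_add_of_commute (Algebra.commutes _ _).symm,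
      ← NormedSpace.algebraMap_exp_comm, ← Real.exp_eq_exp_ℝ, Algebra.algebraMap_eq_smul_one,
      mul_smul_comm, mul_one]
  have h3 := norm_sub_one_mul_exp_le hS1 h1 (mul_pos hl ht)
  rw [hexp]
  nth_rewrite 1 [hBS]
  rw [mul_smul_comm, smul_mul_assoc, norm_smul, norm_smul,
    Real.norm_of_nonneg (Real.exp_pos _).le, Real.norm_of_nonneg hl.le]
  calc Real.exp (-(l * t)) * (l * ‖(S - 1) * NormedSpace.exp ((l * t) • S)‖)
      ≤ Real.exp (-(l * t)) * (l * (Real.exp (l * t) / √(l * t))) := by gcongr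
    _ = (Real.exp (-(l * t)) * Real.exp (l * t)) * (l / √(l * t)) := by ring
    _ = l / √(l * t) := by rw [← Real.exp_add]; simp

end Decay

/-! ### Stochastic matrices and total variation -/

section MatrixNorm

attribute [local instance] Matrix.linftyOpNormedRing Matrix.linftyOpNormedAlgebra

/-- The matrix all of whose rows are `π`: the transition matrix of complete mixing. -/
def constRows {Ω : Type*} (π : Ω → ℝ) : Matrix Ω Ω ℝ := Matrix.of fun _ => π

theorem mul_constRows_apply {Ω : Type*} [Fintype Ω] (M : Matrix Ω Ω ℝ) (π : Ω → ℝ) (i j : Ω) :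
    (M * constRows π) i j = (∑ k, M i k) * π j := by
  simp [Matrix.mul_apply, constRows, Finset.sum_mul]

theorem IsGenerator.mul_constRows {Ω : Type*} [Fintype Ω] {Q : Matrix Ω Ω ℝ}
    (hQ : IsGenerator Q) (π : Ω → ℝ) : Q * constRows π = 0 := by
  ext i j
  rw [mul_constRows_apply, hQ.row_sum, zero_mul, Matrix.zero_apply]

variable {Ω : Type*} [Fintype Ω] [DecidableEq Ω]

theorem linfty_norm_le_iff {M : Matrix Ω Ω ℝ} {c : ℝ} (hc : 0 ≤ c) :
    ‖M‖ ≤ c ↔ ∀ i, ∑ j, |M i j| ≤ c := by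
  lift c to NNReal using hc
  rw [Matrix.linfty_opNorm_def, NNReal.coe_le_coe, Finset.sup_le_iff]
  refine ⟨fun h i => ?_, fun h i _ => ?_⟩
  · simpa [← NNReal.coe_le_coe] using h i (Finset.mem_univ i)
  · simpa [← NNReal.coe_le_coe] using h i

theorem linfty_norm_one_le : ‖(1 : Matrix Ω Ω ℝ)‖ ≤ 1 := by
  rw [linfty_norm_le_iff zero_le_one]
  intro i
  simp [Matrix.one_apply, apply_ite abs]

/-- A bound on the departure rates of a generator says that `Q + l` is `l` times a stochastic
matrix. -/
theorem IsGenerator.norm_add_smul_one_le {Q : Matrix Ω Ω ℝ} (hQ : IsGenerator Q) {l : ℝ}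
    (hl0 : 0 ≤ l) (hl : ∀ i, departureRate Q i ≤ l) :
    ‖Q + l • (1 : Matrix Ω Ω ℝ)‖ ≤ l := by
  rw [linfty_norm_le_iff hl0]
  intro i
  have hd : departureRate Q i = ∑ j ∈ Finset.univ.erase i, Q i j := by
    rw [departureRate]
    congr 1
    ext j
    simp
  have hsum := hQ.row_sum i
  rw [← Finset.add_sum_erase _ _ (Finset.mem_univ i), ← hd] at hsum
  have hli := hl i
  rw [← Finset.add_sum_erase _ _ (Finset.mem_univ i)]
  have h1 : ∑ j ∈ Finset.univ.erase i, |(Q + l • (1 : Matrix Ω Ω ℝ)) i j| = departureRate Q i := by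
    rw [hd]
    refine Finset.sum_congr rfl fun j hj => ?_
    have hij : i ≠ j := (Finset.ne_of_mem_erase hj).symm
    simp [Matrix.one_apply_ne hij, abs_of_nonneg (hQ.rate_nonneg i j hij)]
  have h2 : |(Q + l • (1 : Matrix Ω Ω ℝ)) i i| = Q i i + l := by
    simp only [Matrix.add_apply, Matrix.smul_apply, Matrix.one_apply_eq, smul_eq_mul, mul_one]
    exact abs_of_nonneg (by linarith)
  rw [h1, h2]
  linarith

/-- Uniform closeness in total variation, over all initial distributions, is closeness in the norm:
the extreme initial distributions are the point masses. -/
theorem forall_tvDist_le_iff {M : Matrix Ω Ω ℝ} {π : Ω → ℝ} {δ : ℝ} (hδ : 0 ≤ δ) :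
    (∀ ν ∈ stdSimplex ℝ Ω, tvDist (Matrix.vecMul ν M) π ≤ δ) ↔ ‖M - constRows π‖ ≤ 2 * δ := by
  rw [linfty_norm_le_iff (by positivity)]
  refine ⟨fun h i => ?_, fun h ν hν => ?_⟩
  · have := h (Pi.single i 1) (single_mem_stdSimplex ℝ i)
    rw [Matrix.single_one_vecMul, tvDist] at this
    simp only [Matrix.sub_apply, constRows, Matrix.of_apply]
    simp only [Matrix.row_apply] at this
    linarith
  · have hx : ∀ x, |Matrix.vecMul ν M x - π x| ≤ ∑ i, ν i * |(M - constRows π) i x| := by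
      intro x
      have : Matrix.vecMul ν M x - π x = ∑ i, ν i * (M - constRows π) i x := by
        simp only [Matrix.sub_apply, constRows, Matrix.of_apply, mul_sub, Finset.sum_sub_distrib,
          ← Finset.sum_mul, hν.2, one_mul]
        rfl
      rw [this]
      refine (Finset.abs_sum_le_sum_abs _ _).trans (Finset.sum_le_sum fun i _ => ?_)
      rw [abs_mul, abs_of_nonneg (hν.1 i)]
    have hsum : ∑ x, |Matrix.vecMul ν M x - π x| ≤ 2 * δ :=
      calc _ ≤ ∑ x, ∑ i, ν i * |(M - constRows π) i x| := Finset.sum_le_sum fun x _ => hx x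
        _ = ∑ i, ν i * ∑ x, |(M - constRows π) i x| := by
          rw [Finset.sum_comm]
          simp only [Finset.mul_sum]
        _ ≤ ∑ i, ν i * (2 * δ) :=
          Finset.sum_le_sum fun i _ => mul_le_mul_of_nonneg_left (h i) (hν.1 i)
        _ = 2 * δ := by rw [← Finset.sum_mul, hν.2, one_mul]
    rw [tvDist]
    linarith

/-- A matrix of norm at most one whose rows sum to one has no negative entries. -/
theorem row_mem_stdSimplex {M : Matrix Ω Ω ℝ} (hM : ‖M‖ ≤ 1) (hrow : ∀ i, ∑ j, M i j = 1) (i : Ω) :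
    M i ∈ stdSimplex ℝ Ω := by
  refine ⟨fun j => ?_, hrow i⟩
  have h1 := (linfty_norm_le_iff zero_le_one).1 hM i
  have h2 : |M i j| - M i j ≤ ∑ k, (|M i k| - M i k) :=
    Finset.single_le_sum (f := fun k => |M i k| - M i k)
      (fun k _ => sub_nonneg.2 (le_abs_self _)) (Finset.mem_univ j)
  rw [Finset.sum_sub_distrib, hrow i] at h2
  exact abs_eq_self.1 (le_antisymm (by linarith) (le_abs_self _))

theorem IsGenerator.exp_mul_constRows {Q : Matrix Ω Ω ℝ} (hQ : IsGenerator Q) (π : Ω → ℝ) (t : ℝ) :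
    NormedSpace.exp (t • Q) * constRows π = constRows π := by
  have : CompleteSpace (Matrix Ω Ω ℝ) := FiniteDimensional.complete ℝ _
  exact interpolated_mul_eq (A := Q) (B := Q) (T := 1)
    (X := fun t : ℝ => NormedSpace.exp (t • Q)) (by simp)
    (fun u => by
      have h : (1 - u / 1) • Q + (u / 1) • Q = Q := by module
      rw [h]
      exact hasDerivAt_exp_smul_const Q u)
    (hQ.mul_constRows π) (hQ.mul_constRows π) t

/-! ### Convergence to the unique stationary distribution -/

/-- By compactness the semigroup has a limit point as `t → ∞`. The decay of `Q e^{tQ}` makes every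
row of a limit point a stationary distribution, so uniqueness leaves no choice. -/
theorem exists_norm_exp_sub_constRows_le {Q : Matrix Ω Ω ℝ} (hQ : IsGenerator Q) {l : ℝ} (hl : 0 < l)
    (hd : ∀ i, departureRate Q i ≤ l) {π : Ω → ℝ} (hπ : IsStationaryDist Q π)
    (huniq : ∀ μ, IsStationaryDist Q μ → μ = π) {δ : ℝ} (hδ : 0 < δ) :
    ∃ t : ℝ, 0 ≤ t ∧ ‖NormedSpace.exp (t • Q) - constRows π‖ ≤ δ := by
  have : CompleteSpace (Matrix Ω Ω ℝ) := FiniteDimensional.complete ℝ _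
  have : ProperSpace (Matrix Ω Ω ℝ) := FiniteDimensional.proper ℝ _
  have hB := hQ.norm_add_smul_one_le hl.le hd
  have hmem : ∀ n : ℕ, NormedSpace.exp ((n : ℝ) • Q) ∈
      Metric.closedBall (0 : Matrix Ω Ω ℝ) 1 := fun n =>
    mem_closedBall_zero_iff.2
      (norm_exp_le_one_of_dissipative hB linfty_norm_one_le (Nat.cast_nonneg n))
  obtain ⟨L, hL, φ, hφ, hlim⟩ := (isCompact_closedBall _ _).tendsto_subseq hmem
  have hL1 : ‖L‖ ≤ 1 := by simpa using hL
  have hLπ : L * constRows π = constRows π := by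
    refine tendsto_nhds_unique (hlim.mul_const (constRows π)) ?_
    simp [hQ.exp_mul_constRows]
  have hLQ : L * Q = 0 := by
    refine tendsto_nhds_unique (hlim.mul_const Q) ?_
    have h0 : Filter.Tendsto (fun n : ℕ => l / √(l * (φ n : ℝ))) Filter.atTop (nhds 0) := by
      refine Filter.Tendsto.const_div_atTop (Real.tendsto_sqrt_atTop.comp ?_) l
      exact Filter.Tendsto.const_mul_atTop hl
        (tendsto_natCast_atTop_atTop.comp hφ.tendsto_atTop)
    refine squeeze_zero_norm' ?_ h0
    filter_upwards [Filter.eventually_gt_atTop 0] with n hn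
    have hpos : (0 : ℝ) < φ n := Nat.cast_pos.2 (hn.trans_le (hφ.id_le n))
    have hcomm : NormedSpace.exp ((φ n : ℝ) • Q) * Q = Q * NormedSpace.exp ((φ n : ℝ) • Q) :=
      (((Commute.refl Q).smul_left _).exp_left).eq
    rw [Function.comp_apply, hcomm]
    exact norm_mul_exp_le_of_dissipative hl hB linfty_norm_one_le hpos
  have hrow : ∀ i, ∑ j, L i j = 1 := fun i => by
    have h1 : ∀ j, (∑ k, L i k) * π j = π j := fun j => by
      rw [← mul_constRows_apply, hLπ]
      rfl
    have h2 : ∑ j, (∑ k, L i k) * π j = ∑ j, π j := Finset.sum_congr rfl fun j _ => h1 j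
    rwa [← Finset.mul_sum, hπ.1.2, mul_one] at h2
  have hLeq : L = constRows π := by
    funext i
    refine huniq (L i) ⟨row_mem_stdSimplex hL1 hrow i, ?_⟩
    funext j
    have h3 := congrFun (congrFun hLQ i) j
    rw [Matrix.mul_apply_eq_vecMul] at h3
    exact h3
  rw [hLeq] at hlim
  obtain ⟨n, hn⟩ := ((Metric.tendsto_nhds.1 hlim δ hδ)).exists
  exact ⟨φ n, Nat.cast_nonneg _, by simpa [dist_eq_norm] using hn.le⟩

/-! ### Mixing times and adiabatic times -/

theorem mem_mixingTimes_iff {Q : Matrix Ω Ω ℝ} {π : Ω → ℝ} {δ t : ℝ} (hδ : 0 ≤ δ) :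
    t ∈ mixingTimes Q π δ ↔ 0 ≤ t ∧ ‖NormedSpace.exp (t • Q) - constRows π‖ ≤ 2 * δ :=
  and_congr_right fun _ => forall_tvDist_le_iff hδ

theorem mem_adiabaticTimes_iff {Qi Qf : Matrix Ω Ω ℝ} {π : Ω → ℝ} {ε T : ℝ} (hε : 0 ≤ ε) :
    T ∈ adiabaticTimes Qi Qf π ε ↔
      0 < T ∧ ‖adiabaticTransition Qi Qf T 0 T - constRows π‖ ≤ 2 * ε :=
  and_congr_right fun _ => forall_tvDist_le_iff hε

theorem mixingTime_mem_mixingTimes {Q : Matrix Ω Ω ℝ} {π : Ω → ℝ} {δ : ℝ} (hδ : 0 ≤ δ)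
    (hne : (mixingTimes Q π δ).Nonempty) : mixingTime Q π δ ∈ mixingTimes Q π δ := by
  have : CompleteSpace (Matrix Ω Ω ℝ) := FiniteDimensional.complete ℝ _
  refine IsClosed.csInf_mem ?_ hne ⟨0, fun t ht => ht.1⟩
  have hset : mixingTimes Q π δ =
      Set.Ici 0 ∩ {t : ℝ | ‖NormedSpace.exp (t • Q) - constRows π‖ ≤ 2 * δ} := by
    ext t
    exact mem_mixingTimes_iff hδ
  have hcont : Continuous fun t : ℝ => NormedSpace.exp (t • Q) :=
    continuous_iff_continuousAt.2 fun t => (hasDerivAt_exp_smul_const Q t).continuousAt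
  rw [hset]
  exact isClosed_Ici.inter (isClosed_le (hcont.sub continuous_const).norm continuous_const)

theorem hasDerivAt_adiabaticTransition (Qi Qf : Matrix Ω Ω ℝ) (T s t : ℝ) :
    HasDerivAt (adiabaticTransition Qi Qf T s)
      (adiabaticTransition Qi Qf T s t * ((1 - t / T) • Qi + (t / T) • Qf)) t :=
  (hasDerivAt_pi (E' := fun _ => Ω → ℝ)).2 fun i =>
    hasDerivAt_pi.2 fun j => adiabaticTransition_hasDerivAt Qi Qf T s t i j

/-- A positive infimum of the adiabatic times is attained, by continuity of the final transition
matrix in the time scale. -/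
theorem isLeast_adiabaticTime {Qi Qf : Matrix Ω Ω ℝ} {l : ℝ}
    (hA : ‖Qi + l • (1 : Matrix Ω Ω ℝ)‖ ≤ l) (hB : ‖Qf + l • (1 : Matrix Ω Ω ℝ)‖ ≤ l)
    {π : Ω → ℝ} {ε : ℝ} (hε : 0 ≤ ε) (hne : (adiabaticTimes Qi Qf π ε).Nonempty)
    (hpos : 0 < adiabaticTime Qi Qf π ε) :
    IsLeast (adiabaticTimes Qi Qf π ε) (adiabaticTime Qi Qf π ε) := by
  have hbdd : BddBelow (adiabaticTimes Qi Qf π ε) := ⟨0, fun T hT => hT.1.le⟩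
  have hl : 0 ≤ l := (norm_nonneg _).trans hA
  refine ⟨(mem_adiabaticTimes_iff hε).2 ⟨hpos, ?_⟩, fun T hT => csInf_le hbdd hT⟩
  set T₀ := adiabaticTime Qi Qf π ε with hT₀
  have key : ∀ η : ℝ, 0 < η →
      ‖adiabaticTransition Qi Qf T₀ 0 T₀ - constRows π‖ ≤ 2 * ε + 2 * l * η := by
    intro η hη
    obtain ⟨T, hT, hlt⟩ := Real.lt_sInf_add_pos hne hη
    have hTA := (mem_adiabaticTimes_iff hε).1 hT
    have h1 := norm_interpolated_sub_le hA hB linfty_norm_one_le hpos hTA.1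
      (adiabaticTransition_self Qi Qf T₀ 0) (hasDerivAt_adiabaticTransition Qi Qf T₀ 0)
      (adiabaticTransition_self Qi Qf T 0) (hasDerivAt_adiabaticTransition Qi Qf T 0)
    have h2 : |T₀ - T| ≤ η := by
      have h3 : T₀ ≤ T := csInf_le hbdd hT
      have h4 : T < T₀ + η := hlt
      rw [abs_le]
      constructor <;> linarith
    have h5 : 2 * l * |T₀ - T| ≤ 2 * l * η := by gcongr
    linarith [norm_sub_le_norm_sub_add_norm_sub (adiabaticTransition Qi Qf T₀ 0 T₀)
      (adiabaticTransition Qi Qf T 0 T) (constRows π), hTA.2]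
  have hlim : Filter.Tendsto (fun η : ℝ => 2 * ε + 2 * l * η) (nhdsWithin 0 (Set.Ioi 0))
      (nhds (2 * ε)) := by
    have : Continuous fun η : ℝ => 2 * ε + 2 * l * η := by fun_prop
    simpa using (this.tendsto 0).mono_left nhdsWithin_le_nhds
  exact ge_of_tendsto hlim (Filter.eventually_of_mem self_mem_nhdsWithin key)

theorem mem_adiabaticTimes_of_mem_mixingTimes {Qi Qf : Matrix Ω Ω ℝ} (hQi : IsGenerator Qi)
    (hQf : IsGenerator Qf) {l : ℝ} (hl : 0 ≤ l) (hi : ∀ i, departureRate Qi i ≤ l)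
    (hf : ∀ i, departureRate Qf i ≤ l) {π : Ω → ℝ} {ε τ T : ℝ} (hε : 0 < ε)
    (hτ : τ ∈ mixingTimes Qf π (ε / 2)) (hT : 0 < T)
    (hlT : (τ ≤ T ∧ l * τ ^ 2 ≤ ε * T) ∨ l * τ ^ 2 = ε * T) :
    T ∈ adiabaticTimes Qi Qf π ε := by
  have : CompleteSpace (Matrix Ω Ω ℝ) := FiniteDimensional.complete ℝ _
  have hmix := (mem_mixingTimes_iff (half_pos hε).le).1 hτ
  rw [mul_div_cancel₀ ε two_ne_zero] at hmix
  exact (mem_adiabaticTimes_iff hε.le).2 ⟨hT, norm_interpolated_sub_le_of_norm_exp_sub_le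
    (hQi.norm_add_smul_one_le hl hi) (hQf.norm_add_smul_one_le hl hf) linfty_norm_one_le hT
    (adiabaticTransition_self Qi Qf T 0) (hasDerivAt_adiabaticTransition Qi Qf T 0)
    (hQi.mul_constRows π) (hQf.mul_constRows π) hmix.1 hε hmix.2 hlT⟩

end MatrixNorm

theorem mainTheorem3 {Ω : Type*} [Fintype Ω] [DecidableEq Ω]
    (Qi Qf : Matrix Ω Ω ℝ) (hQi : IsGenerator Qi) (hQf : IsGenerator Qf)
    (πf : Ω → ℝ) (hπ : IsStationaryDist Qf πf) (hπ_unique : ∀ μ, IsStationaryDist Qf μ → μ = πf)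
    (ε : ℝ) (hε : 0 < ε) (lam : ℝ)
    (hlam_i : ∀ i, departureRate Qi i ≤ lam) (hlam_f : ∀ i, departureRate Qf i ≤ lam)
    (hlam : ε / (2 * mixingTime Qf πf (ε / 2)) + 1 ≤ lam) :
    (mixingTimes Qf πf (ε / 2)).Nonempty ∧
    (adiabaticTimes Qi Qf πf ε).Nonempty ∧
    (0 < adiabaticTime Qi Qf πf ε →
      IsLeast (adiabaticTimes Qi Qf πf ε) (adiabaticTime Qi Qf πf ε)) ∧
    adiabaticTime Qi Qf πf ε ≤ lam * mixingTime Qf πf (ε / 2) ^ 2 / ε := by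
  have hτ0 : 0 ≤ mixingTime Qf πf (ε / 2) := Real.sInf_nonneg fun t ht => ht.1
  have hl : 0 < lam := by
    have : 0 ≤ ε / (2 * mixingTime Qf πf (ε / 2)) := by positivity
    linarith
  have hmix : (mixingTimes Qf πf (ε / 2)).Nonempty := by
    obtain ⟨t, ht⟩ := exists_norm_exp_sub_constRows_le hQf hl hlam_f hπ hπ_unique hε
    refine ⟨t, (mem_mixingTimes_iff (half_pos hε).le).2 ?_⟩
    rwa [mul_div_cancel₀ ε two_ne_zero]
  have hτ := mixingTime_mem_mixingTimes (half_pos hε).le hmix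
  set τ := mixingTime Qf πf (ε / 2)
  have hmem : ∀ T, 0 < T → (τ ≤ T ∧ lam * τ ^ 2 ≤ ε * T) ∨ lam * τ ^ 2 = ε * T →
      T ∈ adiabaticTimes Qi Qf πf ε := fun T hT h =>
    mem_adiabaticTimes_of_mem_mixingTimes hQi hQf hl.le hlam_i hlam_f hε hτ hT h
  have hbdd : BddBelow (adiabaticTimes Qi Qf πf ε) := ⟨0, fun T hT => hT.1.le⟩
  have hmain : (adiabaticTimes Qi Qf πf ε).Nonempty ∧
      adiabaticTime Qi Qf πf ε ≤ lam * τ ^ 2 / ε := by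
    rcases hτ0.eq_or_lt with h0 | hpos
    -- Mixing is instantaneous, and every `T > 0` is an adiabatic time.
    · have hall : ∀ T, 0 < T → T ∈ adiabaticTimes Qi Qf πf ε := fun T hT =>
        hmem T hT (Or.inl ⟨h0 ▸ hT.le, by rw [← h0]; simpa using (mul_pos hε hT).le⟩)
      refine ⟨⟨1, hall 1 one_pos⟩, ?_⟩
      rw [← h0]
      refine le_of_forall_pos_le_add fun η hη => (csInf_le hbdd (hall η hη)).trans ?_
      simp
    · have hT : lam * τ ^ 2 / ε ∈ adiabaticTimes Qi Qf πf ε :=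
        hmem _ (by positivity) (Or.inr (by field_simp))
      exact ⟨⟨_, hT⟩, csInf_le hbdd hT⟩
  exact ⟨hmix, hmain.1,
    isLeast_adiabaticTime (hQi.norm_add_smul_one_le hl.le hlam_i)
      (hQf.norm_add_smul_one_le hl.le hlam_f) hε.le hmain.1,
    hmain.2⟩
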